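/- Let $(G,u)$ be an Abelian partially ordered group with interpolation (i.e. whenever $x_1,x_2\le y_1,y_2$ in $G$ there is $z\in G$ with $x_1,x_2\le z\le y_1,y_2$) and with a strong unit $u$ (i.e. $u\ge 0$ and for every $g\in G$ there is an integer $n\ge 1$ with $g\le nu$). Put $G^+=\{g\in G: g\ge 0\}$, and let $E=\Gamma(G,u)=[0,u]$ be the interval effect algebra, where $a+b$ is the sum in $G$ and is defined precisely when $a+b\le u$, with least element $0$ and greatest element $u$. Assume that $E$ has the Riesz decomposition property (RDP): $x_1+x_2=y_1+y_2$ in $E$ implies that there are $c_{11},c_{12},c_{21},c_{22}\in E$ with $x_1=c_{11}+c_{12}$, $x_2=c_{21}+c_{22}$, $y_1=c_{11}+c_{21}$, $y_2=c_{12}+c_{22}$. Assume also that $E$ has countable interpolation: for all sequences $(a_i)$, $(b_j)$ in $E$ with $a_i\le b_j$ for all $i,j$ there is $c\in E$ with $a_i\le c\le b_j$ for all $i,j$. A state on $(G,u)$ is an additive map $s:G\to\mathbb R$ with $s(G^+)\subseteq[0,\infty)$ and $s(u)=1$; a state on $E$ is a map $s:E\to[0,1]$ with $s(u)=1$ and $s(a+b)=s(a)+s(b)$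 whenever $a+b$ is defined in $E$. In both cases $s$ is extremal if $s=\lambda s_1+(1-\lambda)s_2$ with states $s_1,s_2$ and $\lambda\in(0,1)$ implies $s=s_1=s_2$. (1) A state $s$ on $(G,u)$ is extremal if and only if for all $f,g\in G^+$ there is $h\in G^+$ such that $h\le f$, $h\le g$ and $s(h)=\min\{s(f),s(g)\}$. (2) If, in addition, $E$ is divisible (for every $x\in E$ and every integer $n\ge1$ there is $y\in E$ whose $n$-fold sum $ny$ is defined in $E$ and equals $x$), then a state $s$ on $E$ is extremal if and only if for all $f,g\in E$ there is $h\in E$ such that $h\le f$, $h\le g$ and $s(h)=\min\{s(f),s(g)\}$. -/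

import Mathlib

/-- An effect algebra. The partial addition is `add`; `add a b = none` means that `a + b` is
undefined. Equality of the `Option` values in `add_comm'` and `add_assoc'` says that one side is
defined if and only if the other is, and that the two values then agree. -/
class EffectAlgebra (E : Type*) where
  add : E → E → Option E
  zero : E
  one : E
  add_comm' : ∀ a b : E, add a b = add b a
  add_assoc' : ∀ a b c : E,
    (add a b).bind (fun d => add d c) = (add b c).bind (fun d => add a d)
  existsUnique_compl : ∀ a : E, ∃! b : E, add a b = some one
  eq_zero_of_add_one : ∀ a b : E, add a one = some b → a = zero

namespace EffectAlgebra

variable {E : Type*} [EffectAlgebra E]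

/-- The order of an effect algebra: `a ≤ b` if and only if `a + c = b` for some `c`. -/
instance instLE : LE E := ⟨fun a b => ∃ c : E, add a c = some b⟩

/-- The `n`-fold sum `x + ⋯ + x`, where it is defined. -/
def nsum : ℕ → E → Option E
  | 0, _ => some zero
  | n + 1, x => (nsum n x).bind (fun z => add z x)

variable (E)

/-- The Riesz decomposition property (RDP). -/
def RDP : Prop :=
  ∀ x₁ x₂ y₁ y₂ z : E, add x₁ x₂ = some z → add y₁ y₂ = some z →
    ∃ c₁₁ c₁₂ c₂₁ c₂₂ : E,
      add c₁₁ c₁₂ = some x₁ ∧ add c₂₁ c₂₂ = some x₂ ∧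
      add c₁₁ c₂₁ = some y₁ ∧ add c₁₂ c₂₂ = some y₂

/-- Every element `x` has, for every `n ≥ 1`, an `n`-th part: some `y` with `n y = x`. -/
def Divisible : Prop :=
  ∀ n : ℕ, 1 ≤ n → ∀ x : E, ∃ y : E, nsum n y = some x

/-- A state on an effect algebra. -/
structure State where
  toFun : E → ℝ
  mem_Icc' : ∀ a : E, toFun a ∈ Set.Icc (0 : ℝ) 1
  map_one' : toFun one = 1
  map_add' : ∀ a b c : E, add a b = some c → toFun c = toFun a + toFun b

variable {E}

instance : CoeFun (State E) (fun _ => E → ℝ) := ⟨State.toFun⟩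

/-- A state is extremal if it is a proper convex combination of states only trivially. -/
def State.IsExtremal (s : State E) : Prop :=
  ∀ (s₁ s₂ : State E) (t : ℝ), 0 < t → t < 1 →
    (∀ a : E, s a = t * s₁ a + (1 - t) * s₂ a) → s = s₁ ∧ s = s₂

end EffectAlgebra

/-- The (finite, two-by-two) interpolation property. -/
def Interpolation (P : Type*) [LE P] : Prop :=
  ∀ x₁ x₂ y₁ y₂ : P, x₁ ≤ y₁ → x₁ ≤ y₂ → x₂ ≤ y₁ → x₂ ≤ y₂ →
    ∃ z : P, x₁ ≤ z ∧ x₂ ≤ z ∧ z ≤ y₁ ∧ z ≤ y₂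

/-- The countable interpolation property. -/
def CountableInterpolation (P : Type*) [LE P] : Prop :=
  ∀ a b : ℕ → P, (∀ i j, a i ≤ b j) → ∃ c : P, ∀ i j, a i ≤ c ∧ c ≤ b j

section POGroup

variable {G : Type*} [AddCommGroup G] [PartialOrder G] [IsOrderedAddMonoid G]

/-- `u` is a strong unit of the po-group `G`. -/
structure IsStrongUnit (u : G) : Prop where
  nonneg : 0 ≤ u
  exists_le : ∀ g : G, ∃ n : ℕ, 1 ≤ n ∧ g ≤ n • u

/-- A state on the po-group `G` with distinguished element `u`. -/
structure POGroupState (u : G) where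
  toFun : G → ℝ
  map_add' : ∀ g h : G, toFun (g + h) = toFun g + toFun h
  nonneg' : ∀ g : G, 0 ≤ g → 0 ≤ toFun g
  map_unit' : toFun u = 1

instance (u : G) : CoeFun (POGroupState u) (fun _ => G → ℝ) := ⟨POGroupState.toFun⟩

/-- A state is extremal if it is a proper convex combination of states only trivially. -/
def POGroupState.IsExtremal {u : G} (s : POGroupState u) : Prop :=
  ∀ (s₁ s₂ : POGroupState u) (t : ℝ), 0 < t → t < 1 →
    (∀ g : G, s g = t * s₁ g + (1 - t) * s₂ g) → s = s₁ ∧ s = s₂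

/-- The carrier `[0, u]` of the interval effect algebra `Γ(G, u)`. It is a structure of its own,
so that its order is the one of the effect algebra (see `Gamma.le_iff`). -/
@[ext]
structure Gamma (u : G) (hu : 0 ≤ u) where
  val : G
  nonneg : 0 ≤ val
  le_unit : val ≤ u

open Classical in
/-- The addition of `G`, restricted to `[0, u]`. -/
noncomputable def Gamma.add {u : G} {hu : 0 ≤ u} (a b : Gamma u hu) : Option (Gamma u hu) :=
  if h : a.val + b.val ≤ u then some ⟨a.val + b.val, add_nonneg a.nonneg b.nonneg, h⟩ else none

theorem Gamma.add_eq_some {u : G} {hu : 0 ≤ u} {a b c : Gamma u hu} :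
    Gamma.add a b = some c ↔ a.val + b.val = c.val := by
  unfold Gamma.add
  split_ifs with h
  · simp [Gamma.ext_iff]
  · simp only [false_iff]
    intro h'
    exact h (h' ▸ c.le_unit)

/-- The interval effect algebra `Γ(G, u)`. -/
noncomputable instance Gamma.instEffectAlgebra {u : G} {hu : 0 ≤ u} :
    EffectAlgebra (Gamma u hu) where
  add := Gamma.add
  zero := ⟨0, le_rfl, hu⟩
  one := ⟨u, hu, le_rfl⟩
  add_comm' a b := by
    ext c
    simp only [Gamma.add_eq_some, add_comm]
  add_assoc' a b c := by
    ext d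
    simp only [Option.bind_eq_some_iff, Gamma.add_eq_some]
    constructor
    · rintro ⟨e, he, hd⟩
      refine ⟨⟨b.val + c.val, add_nonneg b.nonneg c.nonneg, ?_⟩, rfl, ?_⟩
      · refine le_trans ?_ d.le_unit
        rw [← hd, ← he, add_assoc]
        exact le_add_of_nonneg_left a.nonneg
      · exact (add_assoc _ _ _).symm.trans ((congrArg (· + c.val) he).trans hd)
    · rintro ⟨e, he, hd⟩
      refine ⟨⟨a.val + b.val, add_nonneg a.nonneg b.nonneg, ?_⟩, rfl, ?_⟩
      · refine le_trans ?_ d.le_unit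
        rw [← hd, ← he, ← add_assoc]
        exact le_add_of_nonneg_right c.nonneg
      · exact (add_assoc _ _ _).trans ((congrArg (a.val + ·) he).trans hd)
  existsUnique_compl a := by
    refine ⟨⟨u - a.val, sub_nonneg.2 a.le_unit, sub_le_self u a.nonneg⟩, ?_, ?_⟩
    · simp [Gamma.add_eq_some]
    · intro b hb
      rw [Gamma.add_eq_some] at hb
      ext
      exact eq_sub_of_add_eq' hb
  eq_zero_of_add_one a b h := by
    rw [Gamma.add_eq_some] at h
    ext
    have h1 : a.val + u ≤ u := h.trans_le b.le_unit
    exact le_antisymm (by simpa using h1) a.nonneg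

/-- The order of the effect algebra `Γ(G, u)` is the order of `G`, restricted to `[0, u]`. -/
theorem Gamma.le_iff {u : G} {hu : 0 ≤ u} {a b : Gamma u hu} : a ≤ b ↔ a.val ≤ b.val := by
  constructor
  · rintro ⟨c, hc⟩
    have hc' : a.val + c.val = b.val := Gamma.add_eq_some.1 hc
    rw [← hc']
    exact le_add_of_nonneg_right c.nonneg
  · intro h
    refine ⟨⟨b.val - a.val, sub_nonneg.2 h, (sub_le_self _ a.nonneg).trans b.le_unit⟩, ?_⟩
    exact Gamma.add_eq_some.2 (by simp)

end POGroup

/-! If `s` is extremal, countable interpolation gives a common lower bound `h` of `f` and `g` in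
`[0, u]` with `s h` as large as possible. Then `s` kills every positive lower bound of `p = f - h`
and `q = g - h`. The functional `F x = sup {s k : 0 ≤ k ≤ x, k ≤ n • p for some n}` is additive by
Riesz decomposition and lies below `s`, so extremality makes it a multiple of `s`. As `F p = s p`
and `F q = 0`, `s` vanishes at `p` or at `q`, which is the min condition
(`IsExtremal.eq_zero_or_eq_zero`). Conversely, under the min condition each component of a convex
decomposition of `s` respects the order that `s` induces on the positive cone; comparing `n • f`
with `m • u` forces it to equal `s`. Both statements reduce to `[0, u]`: additive maps extend
uniquely to `G`, and the min condition passes to sums. -/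

theorem EffectAlgebra.State.toFun_injective {E : Type*} [EffectAlgebra E] :
    Function.Injective (EffectAlgebra.State.toFun : EffectAlgebra.State E → E → ℝ) := by
  rintro ⟨⟩ ⟨⟩ rfl
  rfl

section StatesOfInterpolationGroups

set_option linter.unusedSectionVars false

variable {G : Type*} [AddCommGroup G] [PartialOrder G] [IsOrderedAddMonoid G]

/-! ### Riesz decomposition and extension of additive maps from `[0, u]` to `G`. -/

theorem Interpolation.exists_add_of_le_add (hG : Interpolation G) {x a b : G} (hx : 0 ≤ x)
    (ha : 0 ≤ a) (hb : 0 ≤ b) (h : x ≤ a + b) :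
    ∃ y z : G, 0 ≤ y ∧ 0 ≤ z ∧ y ≤ a ∧ z ≤ b ∧ x = y + z := by
  -- Interpolate `0, x - b ≤ y ≤ x, a`; the second part is `x - y`.
  obtain ⟨y, h1, h2, h3, h4⟩ := hG 0 (x - b) x a hx ha (sub_le_self _ hb) (by
    rwa [sub_le_iff_le_add])
  exact ⟨y, x - y, h1, sub_nonneg.2 h3, h4, sub_le_comm.1 h2, by abel⟩

variable {u : G} {hu : 0 ≤ u}

/-- A map on `[0, u]` that turns the sums defined there into sums. -/
def Gamma.IsAdditive (φ : Gamma u hu → ℝ) : Prop :=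
  ∀ a b c : Gamma u hu, a.val + b.val = c.val → φ c = φ a + φ b

/-- The sum in `G` of a list of elements of `[0, u]`. -/
def Gamma.listSum (l : List (Gamma u hu)) : G := (l.map Gamma.val).sum

theorem Gamma.listSum_nonneg (l : List (Gamma u hu)) : 0 ≤ Gamma.listSum l := by
  induction l with
  | nil => simp [Gamma.listSum]
  | cons a l ih => simpa [Gamma.listSum] using add_nonneg a.nonneg ih

theorem Gamma.listSum_append (l m : List (Gamma u hu)) :
    Gamma.listSum (l ++ m) = Gamma.listSum l + Gamma.listSum m := by
  simp [Gamma.listSum]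

theorem Gamma.exists_listSum_eq (hu' : IsStrongUnit u) (hG : Interpolation G) {x : G}
    (hx : 0 ≤ x) : ∃ l : List (Gamma u hu), Gamma.listSum l = x := by
  obtain ⟨n, -, hn⟩ := hu'.exists_le x
  induction n generalizing x with
  | zero => exact ⟨[], by simpa [Gamma.listSum] using le_antisymm hx (by simpa using hn)⟩
  | succ n ih =>
    obtain ⟨y, z, hy, hz, hyn, hzu, rfl⟩ :=
      hG.exists_add_of_le_add hx (nsmul_nonneg hu n) hu (by simpa [succ_nsmul] using hn)
    obtain ⟨l, rfl⟩ := ih hy hyn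
    exact ⟨⟨z, hz, hzu⟩ :: l, by simp [Gamma.listSum, add_comm]⟩

theorem Gamma.exists_listSum_sub_eq (hu' : IsStrongUnit u) (hG : Interpolation G) (g : G) :
    ∃ l m : List (Gamma u hu), g = Gamma.listSum l - Gamma.listSum m := by
  obtain ⟨n, -, hn⟩ := hu'.exists_le g
  obtain ⟨l, hl⟩ := Gamma.exists_listSum_eq (hu := hu) hu' hG (nsmul_nonneg hu n)
  obtain ⟨m, hm⟩ := Gamma.exists_listSum_eq (hu := hu) hu' hG (sub_nonneg.2 hn)
  exact ⟨l, m, by rw [hl, hm]; abel⟩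

/-- Split `a = y + z` with `y` below the head `b` and `z` below the remaining sum; replace `b` by `b
- y` and remove `z` from the tail. -/
theorem Gamma.IsAdditive.exists_remove {φ : Gamma u hu → ℝ} (hφ : Gamma.IsAdditive φ)
    (hG : Interpolation G) (l : List (Gamma u hu)) (a : Gamma u hu)
    (h : a.val ≤ Gamma.listSum l) :
    ∃ m : List (Gamma u hu), Gamma.listSum m + a.val = Gamma.listSum l ∧
      (m.map φ).sum + φ a = (l.map φ).sum := by
  induction l generalizing a with
  | nil =>
    have ha : a.val = 0 := le_antisymm (by simpa [Gamma.listSum] using h) a.nonneg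
    have h0 := hφ a a a (by simp [ha])
    exact ⟨[], by simp [Gamma.listSum, ha], by simp; linarith⟩
  | cons b l ih =>
    have h' : a.val ≤ b.val + Gamma.listSum l := by simpa [Gamma.listSum] using h
    obtain ⟨y, z, hy, hz, hyb, hzl, hyz⟩ :=
      hG.exists_add_of_le_add a.nonneg b.nonneg (Gamma.listSum_nonneg l) h'
    have hza : z ≤ a.val := by rw [hyz]; exact le_add_of_nonneg_left hy
    obtain ⟨m, hm, hmφ⟩ := ih ⟨z, hz, hza.trans a.le_unit⟩ hzl
    have h1 := hφ ⟨y, hy, hyb.trans b.le_unit⟩ ⟨z, hz, hza.trans a.le_unit⟩ a hyz.symm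
    have h2 := hφ ⟨y, hy, hyb.trans b.le_unit⟩
      ⟨b.val - y, sub_nonneg.2 hyb, (sub_le_self _ hy).trans b.le_unit⟩ b (by simp)
    refine ⟨⟨b.val - y, sub_nonneg.2 hyb, (sub_le_self _ hy).trans b.le_unit⟩ :: m, ?_, ?_⟩
    · have e1 : Gamma.listSum (b :: l) = b.val + Gamma.listSum l := by simp [Gamma.listSum]
      have e2 (c : Gamma u hu) : Gamma.listSum (c :: m) = c.val + Gamma.listSum m := by
        simp [Gamma.listSum]
      rw [e1, e2, ← hm]
      simp only [hyz]
      abel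
    · simp only [List.map_cons, List.sum_cons]
      linarith

/-- Removing the entries of `l` from `m` one at a time makes the extension of `φ` to `G` well
defined. -/
theorem Gamma.IsAdditive.sum_eq_of_listSum_eq {φ : Gamma u hu → ℝ} (hφ : Gamma.IsAdditive φ)
    (hG : Interpolation G) (l m : List (Gamma u hu))
    (h : Gamma.listSum l = Gamma.listSum m) : (l.map φ).sum = (m.map φ).sum := by
  induction l generalizing m with
  | nil =>
    have hz : φ ⟨0, le_rfl, hu⟩ = 0 := by
      have := hφ ⟨0, le_rfl, hu⟩ ⟨0, le_rfl, hu⟩ ⟨0, le_rfl, hu⟩ (by simp)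
      linarith
    have h0 : Gamma.listSum m = 0 := by simpa [Gamma.listSum] using h.symm
    have key : ∀ a ∈ m, φ a = 0 := by
      intro a ha
      have h1 : a.val ≤ Gamma.listSum m :=
        List.single_le_sum (by
          intro x hx
          obtain ⟨b, -, rfl⟩ := List.mem_map.1 hx
          exact b.nonneg) _ (List.mem_map_of_mem ha)
      have h2 : a = ⟨0, le_rfl, hu⟩ := by
        ext
        exact le_antisymm (h1.trans h0.le) a.nonneg
      rw [h2, hz]
    symm
    simpa using List.sum_eq_zero (by simpa using key)
  | cons a l ih =>
    have h' : a.val + Gamma.listSum l = Gamma.listSum m := by simpa [Gamma.listSum] using h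
    obtain ⟨k, hk, hkφ⟩ := hφ.exists_remove hG m a (by
      rw [← h']; exact le_add_of_nonneg_right (Gamma.listSum_nonneg l))
    have := ih k (by rw [← h', add_comm a.val] at hk; exact (add_right_cancel hk).symm)
    simp only [List.map_cons, List.sum_cons]
    linarith

/-- An additive map on `[0, u]` extends to a homomorphism on `G`. -/
theorem Gamma.IsAdditive.exists_extension {φ : Gamma u hu → ℝ} (hφ : Gamma.IsAdditive φ)
    (hu' : IsStrongUnit u) (hG : Interpolation G) :
    ∃ F : G →+ ℝ, ∀ a : Gamma u hu, F a.val = φ a := by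
  choose L M hLM using Gamma.exists_listSum_sub_eq (hu := hu) hu' hG
  have key : ∀ (g : G) (l m : List (Gamma u hu)), g = Gamma.listSum l - Gamma.listSum m →
      ((L g).map φ).sum - ((M g).map φ).sum = (l.map φ).sum - (m.map φ).sum := by
    intro g l m h
    have h1 := hφ.sum_eq_of_listSum_eq hG (L g ++ m) (l ++ M g) (by
      rw [Gamma.listSum_append, Gamma.listSum_append]
      have := (hLM g).symm.trans h
      rwa [sub_eq_sub_iff_add_eq_add] at this)
    simp only [List.map_append, List.sum_append] at h1
    linarith
  refine ⟨AddMonoidHom.mk' (fun g => ((L g).map φ).sum - ((M g).map φ).sum) ?_, ?_⟩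
  · intro g g'
    rw [key (g + g') (L g ++ L g') (M g ++ M g') (by
      rw [Gamma.listSum_append, Gamma.listSum_append]
      conv_lhs => rw [hLM g, hLM g']
      abel)]
    simp only [List.map_append, List.sum_append]
    ring
  · intro a
    simpa using key a.val [a] [] (by simp [Gamma.listSum])

theorem AddMonoidHom.map_gammaListSum (F : G →+ ℝ) (l : List (Gamma u hu)) :
    F (Gamma.listSum l) = (l.map fun a => F a.val).sum := by
  rw [Gamma.listSum, map_list_sum, List.map_map]
  rfl

theorem AddMonoidHom.eq_of_eqOn_gamma (hu' : IsStrongUnit u) (hG : Interpolation G)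
    {F F' : G →+ ℝ} (h : ∀ a : Gamma u hu, F a.val = F' a.val) : F = F' := by
  ext g
  obtain ⟨l, m, rfl⟩ := Gamma.exists_listSum_sub_eq (hu := hu) hu' hG g
  simp [AddMonoidHom.map_gammaListSum, h]

theorem AddMonoidHom.nonneg_of_nonneg_on_gamma (hu' : IsStrongUnit u) (hG : Interpolation G)
    {F : G →+ ℝ} (h : ∀ a : Gamma u hu, 0 ≤ F a.val) {g : G} (hg : 0 ≤ g) : 0 ≤ F g := by
  obtain ⟨l, rfl⟩ := Gamma.exists_listSum_eq (hu := hu) hu' hG hg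
  rw [AddMonoidHom.map_gammaListSum]
  exact List.sum_nonneg (by simpa using fun a _ => h a)

/-! ### States as positive homomorphisms. -/

namespace POGroupState

/-- A state as a homomorphism. -/
def toAddMonoidHom (s : POGroupState u) : G →+ ℝ := AddMonoidHom.mk' s.toFun s.map_add'

theorem toAddMonoidHom_apply (s : POGroupState u) (g : G) : s.toAddMonoidHom g = s g := rfl

theorem map_sub (s : POGroupState u) (g h : G) : s (g - h) = s g - s h :=
  _root_.map_sub s.toAddMonoidHom g h

theorem map_zero (s : POGroupState u) : s 0 = 0 := _root_.map_zero s.toAddMonoidHom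

theorem map_nsmul (s : POGroupState u) (n : ℕ) (g : G) : s (n • g) = n * s g := by
  rw [← toAddMonoidHom_apply, _root_.map_nsmul, nsmul_eq_mul, toAddMonoidHom_apply]

theorem mono (s : POGroupState u) {g h : G} (hgh : g ≤ h) : s g ≤ s h := by
  have := s.nonneg' _ (sub_nonneg.2 hgh)
  rw [s.map_sub] at this
  linarith

theorem ext_of_eq {s s' : POGroupState u} (h : ∀ g : G, s g = s' g) : s = s' := by
  cases s
  cases s'
  congr
  exact funext h

/-- A positive homomorphism that does not vanish at `u`, normalized to a state. -/
noncomputable def normalize (F : G →+ ℝ) (hF : ∀ g : G, 0 ≤ g → 0 ≤ F g) (h : 0 < F u) :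
    POGroupState u where
  toFun g := F g / F u
  map_add' g g' := by rw [map_add, add_div]
  nonneg' g hg := div_nonneg (hF g hg) h.le
  map_unit' := div_self h.ne'

theorem normalize_apply (F : G →+ ℝ) (hF : ∀ g : G, 0 ≤ g → 0 ≤ F g) (h : 0 < F u) (g : G) :
    normalize F hF h g = F g / F u := rfl

/-- The positive homomorphisms below an extremal state are its multiples. -/
theorem IsExtremal.eq_mul_of_le (hu' : IsStrongUnit u) {s : POGroupState u}
    (hs : s.IsExtremal) {F : G →+ ℝ} (hF : ∀ g : G, 0 ≤ g → 0 ≤ F g)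
    (hFs : ∀ g : G, 0 ≤ g → F g ≤ s g) {g : G} (hg : 0 ≤ g) : F g = F u * s g := by
  have hsu : s u = 1 := s.map_unit'
  have hzero : ∀ F' : G →+ ℝ, (∀ g : G, 0 ≤ g → 0 ≤ F' g) → F' u = 0 → F' g = 0 := by
    intro F' hF' h0
    obtain ⟨n, -, hn⟩ := hu'.exists_le g
    have h1 := hF' _ (sub_nonneg.2 hn)
    rw [_root_.map_sub, _root_.map_nsmul, h0, smul_zero] at h1
    exact le_antisymm (by linarith) (hF' g hg)
  have hC : ∀ g : G, 0 ≤ g → 0 ≤ (s.toAddMonoidHom - F) g := by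
    intro g hg
    have := hFs g hg
    rw [AddMonoidHom.sub_apply, toAddMonoidHom_apply]
    linarith
  have hCu : (s.toAddMonoidHom - F) u = 1 - F u := by
    rw [AddMonoidHom.sub_apply, toAddMonoidHom_apply, hsu]
  -- If `F u` is `0` or `1`, then `F` or `s - F` vanishes. Otherwise `s` is the convex combination
  -- of the normalized `F` and `s - F` with weights `F u` and `1 - F u`.
  rcases (hF u hu'.nonneg).eq_or_lt with h0 | h0
  · rw [hzero F hF h0.symm, ← h0, zero_mul]
  · have h1 := hC u hu'.nonneg
    rw [hCu] at h1
    rcases h1.eq_or_lt with h1 | h1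
    · have := hzero _ hC (hCu.trans h1.symm)
      rw [AddMonoidHom.sub_apply, toAddMonoidHom_apply] at this
      rw [show F u = 1 by linarith]
      linarith
    · have h2 := (hs (normalize F hF h0) (normalize _ hC (hCu ▸ h1)) (F u) h0 (by linarith) (by
        intro g
        rw [normalize_apply, normalize_apply, hCu, mul_div_cancel₀ _ h0.ne',
          mul_div_cancel₀ _ h1.ne', AddMonoidHom.sub_apply, toAddMonoidHom_apply]
        ring)).1
      rw [h2, normalize_apply, mul_div_cancel₀ _ h0.ne']

/-! ### Extremal states and the min condition on `[0, u]`. -/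

/-- The values of `s` at the positive elements below `x` and below a multiple of `p`. -/
def valuesBelow (s : POGroupState u) (p x : G) : Set ℝ :=
  {r | ∃ k : G, 0 ≤ k ∧ k ≤ x ∧ (∃ n : ℕ, k ≤ n • p) ∧ s k = r}

theorem valuesBelow_bddAbove (s : POGroupState u) (p x : G) : BddAbove (s.valuesBelow p x) :=
  ⟨s x, by rintro _ ⟨k, -, hk, -, rfl⟩; exact s.mono hk⟩

theorem zero_mem_valuesBelow (s : POGroupState u) (p : G) {x : G} (hx : 0 ≤ x) :
    0 ∈ s.valuesBelow p x :=
  ⟨0, le_rfl, hx, ⟨0, by simp⟩, s.map_zero⟩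

theorem sSup_valuesBelow_add (hG : Interpolation G) (s : POGroupState u) {p x y : G}
    (hx : 0 ≤ x) (hy : 0 ≤ y) :
    sSup (s.valuesBelow p (x + y)) = sSup (s.valuesBelow p x) + sSup (s.valuesBelow p y) := by
  have hx0 : (s.valuesBelow p x).Nonempty := ⟨_, s.zero_mem_valuesBelow p hx⟩
  have hy0 : (s.valuesBelow p y).Nonempty := ⟨_, s.zero_mem_valuesBelow p hy⟩
  rw [← csSup_add hx0 (s.valuesBelow_bddAbove p x) hy0 (s.valuesBelow_bddAbove p y)]
  congr 1
  ext r
  rw [Set.mem_add]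
  constructor
  · rintro ⟨k, hk, hkxy, ⟨n, hn⟩, rfl⟩
    obtain ⟨a, b, ha, hb, hax, hby, rfl⟩ := hG.exists_add_of_le_add hk hx hy hkxy
    exact ⟨s a, ⟨a, ha, hax, ⟨n, (le_add_of_nonneg_right hb).trans hn⟩, rfl⟩,
      s b, ⟨b, hb, hby, ⟨n, (le_add_of_nonneg_left ha).trans hn⟩, rfl⟩, (s.map_add' a b).symm⟩
  · rintro ⟨_, ⟨a, ha, hax, ⟨n, hn⟩, rfl⟩, _, ⟨b, hb, hby, ⟨m, hm⟩, rfl⟩, rfl⟩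
    exact ⟨a + b, add_nonneg ha hb, add_le_add hax hby,
      ⟨n + m, by rw [add_nsmul]; exact add_le_add hn hm⟩, s.map_add' a b⟩

/-- If `p` and `q` have no common positive lower bound outside the kernel of an extremal state,
then that state vanishes at `p` or at `q`. -/
theorem IsExtremal.eq_zero_or_eq_zero (hu' : IsStrongUnit u) (hG : Interpolation G)
    {s : POGroupState u} (hs : s.IsExtremal) {p q : G} (hp : 0 ≤ p) (hq : 0 ≤ q)
    (hpu : p ≤ u) (hqu : q ≤ u) (h : ∀ k : G, 0 ≤ k → k ≤ p → k ≤ q → s k = 0) :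
    s p = 0 ∨ s q = 0 := by
  have hadd : Gamma.IsAdditive
      (fun a : Gamma u hu'.nonneg => sSup (s.valuesBelow p a.val)) := by
    intro a b c habc
    simp only [← habc]
    exact s.sSup_valuesBelow_add hG a.nonneg b.nonneg
  obtain ⟨F, hF⟩ := hadd.exists_extension hu' hG
  have hF0 : ∀ g : G, 0 ≤ g → 0 ≤ F g := by
    intro g hg
    refine AddMonoidHom.nonneg_of_nonneg_on_gamma (hu := hu'.nonneg) hu' hG (fun a => ?_) hg
    rw [hF]
    exact le_csSup (s.valuesBelow_bddAbove p _) (s.zero_mem_valuesBelow p a.nonneg)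
  have hFs : ∀ g : G, 0 ≤ g → F g ≤ s g := by
    intro g hg
    have : 0 ≤ (s.toAddMonoidHom - F) g := by
      refine AddMonoidHom.nonneg_of_nonneg_on_gamma (hu := hu'.nonneg) hu' hG (fun a => ?_) hg
      rw [AddMonoidHom.sub_apply, hF, sub_nonneg]
      refine csSup_le ⟨_, s.zero_mem_valuesBelow p a.nonneg⟩ ?_
      rintro _ ⟨k, -, hk, -, rfl⟩
      exact s.mono hk
    rw [AddMonoidHom.sub_apply, toAddMonoidHom_apply] at this
    linarith
  have hFp : s p ≤ F p :=
    (le_csSup (s.valuesBelow_bddAbove p p) ⟨p, hp, le_rfl, ⟨1, by simp⟩, rfl⟩).trans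
      (hF ⟨p, hp, hpu⟩).ge
  -- An element below `q` and `n • p` is a sum of `n` elements below both `p` and `q`.
  have hmul : ∀ (n : ℕ) (k : G), 0 ≤ k → k ≤ q → k ≤ n • p → s k = 0 := by
    intro n
    induction n with
    | zero =>
      intro k hk _ hkn
      rw [le_antisymm (by simpa using hkn) hk, s.map_zero]
    | succ n ih =>
      intro k hk hkq hkn
      obtain ⟨a, b, ha, hb, han, hbp, rfl⟩ :=
        hG.exists_add_of_le_add hk (nsmul_nonneg hp n) hp (by rwa [succ_nsmul] at hkn)
      rw [s.map_add', ih a ha ((le_add_of_nonneg_right hb).trans hkq) han,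
        h b hb hbp ((le_add_of_nonneg_left ha).trans hkq), add_zero]
  have hFq : F q ≤ 0 := by
    rw [hF ⟨q, hq, hqu⟩]
    refine csSup_le ⟨_, s.zero_mem_valuesBelow p hq⟩ ?_
    rintro _ ⟨k, hk, hkq, ⟨n, hn⟩, rfl⟩
    exact (hmul n k hk hkq hn).le
  have ep := hs.eq_mul_of_le hu' hF0 hFs hp
  have eq := hs.eq_mul_of_le hu' hF0 hFs hq
  have hq0 := hF0 q hq
  rcases mul_eq_zero.1 (eq.symm.trans (le_antisymm hFq hq0)) with h0 | h0
  · left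
    rw [h0, zero_mul] at ep
    exact le_antisymm (by linarith) (s.nonneg' p hp)
  · exact Or.inr h0

/-- An element interpolated between a maximizing sequence and `f, g` attains the supremum. -/
theorem exists_isMax_of_countableInterpolation (s : POGroupState u)
    (hCI : CountableInterpolation (Gamma u hu)) (f g : Gamma u hu) :
    ∃ h : Gamma u hu, h ≤ f ∧ h ≤ g ∧
      ∀ k : Gamma u hu, k ≤ f → k ≤ g → s k.val ≤ s h.val := by
  set S : Set ℝ := {r | ∃ k : Gamma u hu, k ≤ f ∧ k ≤ g ∧ s k.val = r}
  have hne : S.Nonempty :=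
    ⟨_, ⟨0, le_rfl, hu⟩, Gamma.le_iff.2 f.nonneg, Gamma.le_iff.2 g.nonneg, rfl⟩
  have hbdd : BddAbove S := ⟨s f.val, by
    rintro _ ⟨k, hk, -, rfl⟩
    exact s.mono (Gamma.le_iff.1 hk)⟩
  obtain ⟨v, -, hv, hvS⟩ := exists_seq_tendsto_sSup hne hbdd
  choose a haf hag hav using hvS
  obtain ⟨c, hc⟩ := hCI a (fun j => if j = 0 then f else g) (by
    intro i j
    split_ifs
    exacts [haf i, hag i])
  refine ⟨c, by simpa using (hc 0 0).2, by simpa using (hc 0 1).2, fun k hkf hkg => ?_⟩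
  refine (le_csSup hbdd ⟨k, hkf, hkg, rfl⟩).trans (le_of_tendsto' hv fun n => ?_)
  rw [← hav n]
  exact s.mono (Gamma.le_iff.1 (hc n 0).1)

theorem IsExtremal.exists_eq_min (hu' : IsStrongUnit u) (hG : Interpolation G)
    (hCI : CountableInterpolation (Gamma u hu)) {s : POGroupState u} (hs : s.IsExtremal)
    (f g : Gamma u hu) :
    ∃ h : Gamma u hu, h ≤ f ∧ h ≤ g ∧ s h.val = min (s f.val) (s g.val) := by
  obtain ⟨h, hhf, hhg, hmax⟩ := s.exists_isMax_of_countableInterpolation hCI f g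
  have hf := Gamma.le_iff.1 hhf
  have hg := Gamma.le_iff.1 hhg
  refine ⟨h, hhf, hhg, ?_⟩
  have h1 := hs.eq_zero_or_eq_zero hu' hG (sub_nonneg.2 hf) (sub_nonneg.2 hg)
    -- If `k` is below both differences, `h + k` is again a common lower bound, so maximality gives
    -- `s k = 0`.
    ((sub_le_self _ h.nonneg).trans f.le_unit) ((sub_le_self _ h.nonneg).trans g.le_unit) (by
      intro k hk hkf hkg
      have hkf' : h.val + k ≤ f.val := by rwa [le_sub_iff_add_le'] at hkf
      have hkg' : h.val + k ≤ g.val := by rwa [le_sub_iff_add_le'] at hkg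
      have := hmax ⟨h.val + k, add_nonneg h.nonneg hk, hkf'.trans f.le_unit⟩
        (Gamma.le_iff.2 hkf') (Gamma.le_iff.2 hkg')
      rw [s.map_add'] at this
      exact le_antisymm (by linarith) (s.nonneg' k hk))
  have h2 := s.mono hf
  have h3 := s.mono hg
  rw [s.map_sub, s.map_sub] at h1
  rcases h1 with h1 | h1
  · rw [min_eq_left] <;> linarith
  · rw [min_eq_right] <;> linarith

/-! ### From the min condition back to extremality. -/

/-- `f` and `g` have a common positive lower bound at which `s` takes the smaller of its values
at `f` and `g`. -/
def AttainsMin (s : POGroupState u) (f g : G) : Prop :=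
  ∃ h : G, 0 ≤ h ∧ h ≤ f ∧ h ≤ g ∧ s h = min (s f) (s g)

theorem AttainsMin.symm {s : POGroupState u} {f g : G} (h : s.AttainsMin f g) :
    s.AttainsMin g f := by
  obtain ⟨k, hk, hkf, hkg, e⟩ := h
  exact ⟨k, hk, hkg, hkf, by rw [e, min_comm]⟩

/-- If `s f ≤ s g`, the witness `k` uses up the value of `f`, and `f'` is then compared with `g -
k`; this is why `h'` ranges over all `g' ≤ g`. Otherwise `k` already serves. -/
theorem attainsMin_add_left {s : POGroupState u} {f f' g : G}
    (hf' : 0 ≤ f') (h : s.AttainsMin f g)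
    (h' : ∀ g', 0 ≤ g' → g' ≤ g → s.AttainsMin f' g') : s.AttainsMin (f + f') g := by
  obtain ⟨k, hk, hkf, hkg, e⟩ := h
  have hf0 := s.nonneg' f' hf'
  rcases le_total (s f) (s g) with hle | hle
  · rw [min_eq_left hle] at e
    obtain ⟨k', hk', hkf', hkg', e'⟩ := h' (g - k) (sub_nonneg.2 hkg) (sub_le_self _ hk)
    refine ⟨k + k', add_nonneg hk hk', add_le_add hkf hkf', by rwa [le_sub_iff_add_le'] at hkg',
      ?_⟩
    rw [s.map_add', s.map_add', e', e, s.map_sub, e, ← min_add_add_left, add_sub_cancel]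
  · rw [min_eq_right hle] at e
    refine ⟨k, hk, hkf.trans (le_add_of_nonneg_right hf'), hkg, ?_⟩
    rw [e, s.map_add', min_eq_right (by linarith)]

theorem attainsMin_listSum_left {s : POGroupState u} {g : G} (hg : 0 ≤ g)
    (l : List (Gamma u hu))
    (h : ∀ (a : Gamma u hu) (g' : G), 0 ≤ g' → g' ≤ g → s.AttainsMin a.val g') :
    s.AttainsMin (Gamma.listSum l) g := by
  induction l generalizing g with
  | nil =>
    refine ⟨0, le_rfl, by simp [Gamma.listSum], hg, ?_⟩
    simp [Gamma.listSum, s.map_zero, s.nonneg' g hg]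
  | cons a l ih =>
    have e : Gamma.listSum (a :: l) = a.val + Gamma.listSum l := by simp [Gamma.listSum]
    rw [e]
    exact attainsMin_add_left (Gamma.listSum_nonneg l) (h a g hg le_rfl)
      fun g' hg' hg'g => ih hg' fun b g'' h1 h2 => h b g'' h1 (h2.trans hg'g)

theorem attainsMin_of_gamma (hu' : IsStrongUnit u) (hG : Interpolation G) {s : POGroupState u}
    (h : ∀ a b : Gamma u hu, s.AttainsMin a.val b.val) {f g : G} (hf : 0 ≤ f) (hg : 0 ≤ g) :
    s.AttainsMin f g := by
  obtain ⟨l, rfl⟩ := Gamma.exists_listSum_eq (hu := hu) hu' hG hf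
  refine attainsMin_listSum_left hg l fun a g' hg' _ => ?_
  obtain ⟨m, rfl⟩ := Gamma.exists_listSum_eq (hu := hu) hu' hG hg'
  refine (attainsMin_listSum_left a.nonneg m fun b a' ha' ha'a => ?_).symm
  exact h b ⟨a', ha', ha'a.trans a.le_unit⟩

theorem isExtremal_of_attainsMin (hu' : IsStrongUnit u) {s : POGroupState u}
    (h : ∀ f g : G, 0 ≤ f → 0 ≤ g → s.AttainsMin f g) : s.IsExtremal := by
  have key : ∀ (s₁ s₂ : POGroupState u) (t : ℝ), 0 < t → t < 1 →
      (∀ g : G, s g = t * s₁ g + (1 - t) * s₂ g) → s = s₁ := by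
    intro s₁ s₂ t ht0 ht1 e
    -- With `k` a witness for `s k = s f`, `s` vanishes at `f - k ≥ 0`, hence so does `s₁`, and `s₁
    -- f = s₁ k ≤ s₁ g`.
    have hmono : ∀ f g : G, 0 ≤ f → 0 ≤ g → s f ≤ s g → s₁ f ≤ s₁ g := by
      intro f g hf hg hle
      obtain ⟨k, hk, hkf, hkg, ek⟩ := h f g hf hg
      rw [min_eq_left hle] at ek
      have h0 : s (f - k) = 0 := by rw [s.map_sub, ek, sub_self]
      have h1 := s₁.nonneg' _ (sub_nonneg.2 hkf)
      have h2 := s₂.nonneg' _ (sub_nonneg.2 hkf)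
      rw [e] at h0
      have h3 : s₁ (f - k) = 0 := by
        have := mul_nonneg (sub_nonneg.2 ht1.le) h2
        have h4 := mul_nonneg ht0.le h1
        rcases mul_eq_zero.1 (show t * s₁ (f - k) = 0 by linarith) with h5 | h5
        · exact absurd h5 ht0.ne'
        · exact h5
      rw [s₁.map_sub] at h3
      have := s₁.mono hkg
      linarith
    have hsu : s u = 1 := s.map_unit'
    have hsu₁ : s₁ u = 1 := s₁.map_unit'
    have hpos : ∀ f : G, 0 ≤ f → s f = s₁ f := by
      intro f hf
      have hrat : ∀ n m : ℕ, 0 < n →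
          (s f ≤ m / n → s₁ f ≤ m / n) ∧ ((m / n : ℝ) ≤ s f → (m / n : ℝ) ≤ s₁ f) := by
        intro n m hn
        have hn' : (0 : ℝ) < n := by exact_mod_cast hn
        have h1 := hmono (n • f) (m • u) (nsmul_nonneg hf n) (nsmul_nonneg hu'.nonneg m)
        have h2 := hmono (m • u) (n • f) (nsmul_nonneg hu'.nonneg m) (nsmul_nonneg hf n)
        simp only [map_nsmul, hsu, hsu₁, mul_one] at h1 h2
        rw [le_div_iff₀' hn', le_div_iff₀' hn', div_le_iff₀' hn', div_le_iff₀' hn']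
        exact ⟨h1, h2⟩
      have hq : ∀ q : ℚ, 0 ≤ q → ∃ n m : ℕ, 0 < n ∧ (q : ℝ) = m / n := by
        intro q hq
        refine ⟨q.den, q.num.toNat, q.den_pos, ?_⟩
        have h1 : ((q.num.toNat : ℤ) : ℝ) = (q.num : ℝ) := by
          rw [Int.toNat_of_nonneg (Rat.num_nonneg.2 hq)]
        rw [Rat.cast_def, ← h1, Int.cast_natCast]
      refine le_antisymm (le_of_not_gt fun hlt => ?_) (le_of_not_gt fun hlt => ?_)
      · obtain ⟨q, hq1, hq2⟩ := exists_rat_btwn hlt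
        obtain ⟨n, m, hn, e'⟩ := hq q (by
          exact_mod_cast (s₁.nonneg' f hf).trans hq1.le)
        rw [e'] at hq1 hq2
        exact absurd ((hrat n m hn).2 hq2.le) (not_le.2 hq1)
      · obtain ⟨q, hq1, hq2⟩ := exists_rat_btwn hlt
        obtain ⟨n, m, hn, e'⟩ := hq q (by
          exact_mod_cast (s.nonneg' f hf).trans hq1.le)
        rw [e'] at hq1 hq2
        exact absurd ((hrat n m hn).1 hq1.le) (not_le.2 hq2)
    refine ext_of_eq fun g => ?_
    -- Any `g` is `n • u` minus a positive element.
    obtain ⟨n, -, hn⟩ := hu'.exists_le g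
    have := hpos _ (sub_nonneg.2 hn)
    rw [s.map_sub, s₁.map_sub, map_nsmul, map_nsmul, hsu, hsu₁] at this
    linarith
  intro s₁ s₂ t ht0 ht1 e
  exact ⟨key s₁ s₂ t ht0 ht1 e, key s₂ s₁ (1 - t) (by linarith) (by linarith) fun g => by
    rw [e g]; ring⟩

theorem isExtremal_iff_gamma (hu' : IsStrongUnit u) (hG : Interpolation G)
    (hCI : CountableInterpolation (Gamma u hu)) (s : POGroupState u) :
    s.IsExtremal ↔ ∀ f g : Gamma u hu,
      ∃ h : Gamma u hu, h ≤ f ∧ h ≤ g ∧ s h.val = min (s f.val) (s g.val) := by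
  refine ⟨fun hs => hs.exists_eq_min hu' hG hCI, fun h => ?_⟩
  refine isExtremal_of_attainsMin hu' fun f g => attainsMin_of_gamma (hu := hu) hu' hG fun a b => ?_
  obtain ⟨k, hka, hkb, e⟩ := h a b
  exact ⟨k.val, k.nonneg, Gamma.le_iff.1 hka, Gamma.le_iff.1 hkb, e⟩

/-! ### The affine bijection between states on `G` and states on `[0, u]`. -/

/-- The restriction of a state to `[0, u]`. -/
def restrict (s : POGroupState u) (hu : 0 ≤ u) : EffectAlgebra.State (Gamma u hu) where
  toFun a := s a.val
  mem_Icc' a := ⟨s.nonneg' _ a.nonneg, (s.mono a.le_unit).trans s.map_unit'.le⟩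
  map_one' := s.map_unit'
  map_add' a b c h := by
    rw [← Gamma.add_eq_some.1 h]
    exact s.map_add' _ _

theorem restrict_apply (s : POGroupState u) (a : Gamma u hu) : s.restrict hu a = s a.val := rfl

theorem restrict_injective (hu' : IsStrongUnit u) (hG : Interpolation G) :
    Function.Injective fun s : POGroupState u => s.restrict hu := by
  intro s s' h
  have := AddMonoidHom.eq_of_eqOn_gamma (hu := hu) hu' hG
    (F := s.toAddMonoidHom) (F' := s'.toAddMonoidHom) fun a => by
      have h1 : s.restrict hu = s'.restrict hu := h
      rw [toAddMonoidHom_apply, toAddMonoidHom_apply, ← restrict_apply, h1, restrict_apply]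
  exact ext_of_eq fun g => DFunLike.congr_fun this g

theorem restrict_surjective (hu' : IsStrongUnit u) (hG : Interpolation G) :
    Function.Surjective fun s : POGroupState u => s.restrict hu := by
  intro s
  have hadd : Gamma.IsAdditive (s : Gamma u hu → ℝ) := fun a b c h =>
    s.map_add' a b c (Gamma.add_eq_some.2 h)
  obtain ⟨F, hF⟩ := hadd.exists_extension hu' hG
  refine ⟨⟨F, fun g h => map_add F g h, fun g hg => ?_, ?_⟩, ?_⟩
  · refine AddMonoidHom.nonneg_of_nonneg_on_gamma (hu := hu) hu' hG (fun a => ?_) hg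
    rw [hF]
    exact (s.mem_Icc' a).1
  · exact (hF ⟨u, hu, le_rfl⟩).trans s.map_one'
  · exact EffectAlgebra.State.toFun_injective (funext hF)

theorem restrict_isExtremal_iff (hu' : IsStrongUnit u) (hG : Interpolation G)
    (s : POGroupState u) : (s.restrict hu).IsExtremal ↔ s.IsExtremal := by
  constructor
  · intro hs s₁ s₂ t ht0 ht1 e
    obtain ⟨h1, h2⟩ := hs (s₁.restrict hu) (s₂.restrict hu) t ht0 ht1 fun a => e a.val
    exact ⟨restrict_injective hu' hG h1, restrict_injective hu' hG h2⟩
  · intro hs σ₁ σ₂ t ht0 ht1 e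
    obtain ⟨s₁, rfl⟩ := restrict_surjective hu' hG σ₁
    obtain ⟨s₂, rfl⟩ := restrict_surjective hu' hG σ₂
    -- The convex relation holds on `[0, u]`, so it holds on `G`.
    have key := AddMonoidHom.eq_of_eqOn_gamma (hu := hu) hu' hG (F := s.toAddMonoidHom)
      (F' := (AddMonoidHom.mulLeft t).comp s₁.toAddMonoidHom +
        (AddMonoidHom.mulLeft (1 - t)).comp s₂.toAddMonoidHom) e
    obtain ⟨h1, h2⟩ := hs s₁ s₂ t ht0 ht1 fun g => DFunLike.congr_fun key g
    exact ⟨congrArg (fun σ => restrict σ hu) h1, congrArg (fun σ => restrict σ hu) h2⟩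

end POGroupState

end StatesOfInterpolationGroups

theorem mainTheorem9 {G : Type*} [AddCommGroup G] [PartialOrder G] [IsOrderedAddMonoid G]
    (u : G) (hu : IsStrongUnit u) (hG : Interpolation G)
    (hRDP : EffectAlgebra.RDP (Gamma u hu.nonneg))
    (hCI : CountableInterpolation (Gamma u hu.nonneg)) :
    (∀ s : POGroupState u,
      s.IsExtremal ↔
        ∀ f g : G, 0 ≤ f → 0 ≤ g →
          ∃ h : G, 0 ≤ h ∧ h ≤ f ∧ h ≤ g ∧ s h = min (s f) (s g)) ∧
    (EffectAlgebra.Divisible (Gamma u hu.nonneg) →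
      ∀ s : EffectAlgebra.State (Gamma u hu.nonneg),
        s.IsExtremal ↔
          ∀ f g : Gamma u hu.nonneg,
            ∃ h : Gamma u hu.nonneg, h ≤ f ∧ h ≤ g ∧ s h = min (s f) (s g)) := by
  refine ⟨fun s => ⟨fun hs f g hf hg => ?_, fun h =>
    POGroupState.isExtremal_of_attainsMin hu h⟩, fun _ s => ?_⟩
  · refine POGroupState.attainsMin_of_gamma (hu := hu.nonneg) hu hG (fun a b => ?_) hf hg
    obtain ⟨k, hka, hkb, e⟩ := hs.exists_eq_min hu hG hCI a b
    exact ⟨k.val, k.nonneg, Gamma.le_iff.1 hka, Gamma.le_iff.1 hkb, e⟩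
  · obtain ⟨S, rfl⟩ := POGroupState.restrict_surjective hu hG s
    exact (S.restrict_isExtremal_iff hu hG).trans (S.isExtremal_iff_gamma hu hG hCI)
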